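/- All graphs are finite and simple; $v_G$ and $e_G$ denote the numbers of vertices and edges of a graph $G$. For a graph $H$ with $v_H\ge 3$ let $$m^*(H):=\min_{J\subseteq H,\ 2\le v_J<v_H}\frac{e_H-e_J}{v_H-v_J},$$ the minimum being over all (not necessarily induced) subgraphs $J$ of $H$. If $m^*(H)=0$, read $n^{-1/m^*(H)}$ as $0$. For $\rho>0$ and $0<d\le 1$, a graph $F$ on the vertex set $[n]=\{1,\dots,n\}$ is called $(\rho,d)$-dense if every $S\subseteq[n]$ with $|S|\ge\rho n$ satisfies $e(F[S])\ge d\binom{|S|}{2}$, where $F[S]$ is the subgraph of $F$ induced on $S$. Let $G_{n,p}$ be the binomial random graph on $[n]$ with edge probability $p$. **Lemma 2.11.** Let $H$ be a graph with at least one edge and $v_H\ge 3$. For every $0<d\le 1$ there exist positive constants $\rho$, $n_0$ and $b$ such that for all $n\ge n_0$ and all $0\le p\le 1$ with $p\le n^{-1/m^*(H)}$ the following holds: if $F$ is a $(\rho,d)$-dense graph on $[n]$, then, with probability at least $$1-2^{\,1-b\,n^{v_H}p^{e_H}},$$ the graph $F\cap G_{n,p}$ contains a family of at least $b\,n^{v_H}p^{e_H}$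 pairwise edge-disjoint copies of $H$ (a copy of $H$ being a subgraph isomorphic to $H$). -/

import Mathlib

open scoped Finset

/-- The parameter `m*(H)`: the minimum of `(e_H - e_J) / (v_H - v_J)` over all (not necessarily
induced) subgraphs `J ⊆ H` with `2 ≤ v_J < v_H`. For `3 ≤ v_H` the infimum below is over a finite
nonempty set, see `SimpleGraph.isLeast_mStar`. -/
noncomputable def SimpleGraph.mStar {V : Type*} [Fintype V] (H : SimpleGraph V) : ℝ :=
  sInf {x : ℝ | ∃ J : H.Subgraph, 2 ≤ J.verts.ncard ∧ J.verts.ncard < Fintype.card V ∧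
    x = ((H.edgeSet.ncard : ℝ) - J.edgeSet.ncard) / ((Fintype.card V : ℝ) - J.verts.ncard)}

/-- The infimum in the definition of `m*(H)` is a minimum. -/
theorem SimpleGraph.isLeast_mStar {V : Type*} [Fintype V] (H : SimpleGraph V)
    (hV : 3 ≤ Fintype.card V) :
    IsLeast {x : ℝ | ∃ J : H.Subgraph, 2 ≤ J.verts.ncard ∧ J.verts.ncard < Fintype.card V ∧
      x = ((H.edgeSet.ncard : ℝ) - J.edgeSet.ncard) / ((Fintype.card V : ℝ) - J.verts.ncard)}
      H.mStar := by
  classical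
  have hfin : Finite H.Subgraph := inferInstance
  set S := {x : ℝ | ∃ J : H.Subgraph, 2 ≤ J.verts.ncard ∧ J.verts.ncard < Fintype.card V ∧
      x = ((H.edgeSet.ncard : ℝ) - J.edgeSet.ncard) / ((Fintype.card V : ℝ) - J.verts.ncard)}
  have hS : S.Finite := by
    refine (Set.finite_range fun J : H.Subgraph =>
      ((H.edgeSet.ncard : ℝ) - J.edgeSet.ncard) / ((Fintype.card V : ℝ) - J.verts.ncard)).subset ?_
    rintro x ⟨J, -, -, rfl⟩
    exact ⟨J, rfl⟩
  have hne : S.Nonempty := by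
    obtain ⟨s, -, hs⟩ := Finset.exists_subset_card_eq
      (s := (Finset.univ : Finset V)) (n := 2) (by rw [Finset.card_univ]; omega)
    refine ⟨_, (⊤ : H.Subgraph).induce (s : Set V), ?_, ?_, rfl⟩
    · simp [Set.ncard_coe_finset, hs]
    · simp only [SimpleGraph.Subgraph.induce_verts, Set.ncard_coe_finset, hs]
      omega
  exact ⟨hne.csInf_mem hS, fun x hx => csInf_le hS.bddBelow hx⟩

/-- The quantity `n^{-1/m*(H)}`. If `m*(H) = 0` (equivalently, `H` has an isolated vertex), this
is `n^{-∞}`, that is `0`. -/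
noncomputable def SimpleGraph.edgeProbBound {V : Type*} [Fintype V] (H : SimpleGraph V)
    (n : ℕ) : ℝ :=
  open Classical in
  if H.mStar = 0 then 0 else (n : ℝ) ^ (-1 / H.mStar)

/-- A graph `F` on `n` vertices is `(ρ, d)`-dense if every set `S` of at least `ρ n` vertices spans
at least `d * (|S| choose 2)` edges of `F`. -/
def SimpleGraph.IsRhoDense {n : ℕ} (F : SimpleGraph (Fin n)) (ρ d : ℝ) : Prop :=
  ∀ S : Finset (Fin n), ρ * n ≤ #S →
    d * ((#S).choose 2 : ℝ) ≤ ((F.induce (S : Set (Fin n))).edgeSet.ncard : ℝ)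

/-- `G` contains a family of at least `t` pairwise edge-disjoint copies of `H`, a copy of `H` in `G`
being a subgraph of `G` that is isomorphic to `H`. -/
def SimpleGraph.HasEdgeDisjointCopies {V W : Type*} (H : SimpleGraph V) (G : SimpleGraph W)
    (t : ℝ) : Prop :=
  ∃ C : Finset G.Subgraph, t ≤ #C ∧ (∀ K ∈ C, Nonempty (H ≃g K.coe)) ∧
    (C : Set G.Subgraph).Pairwise fun K L => Disjoint K.edgeSet L.edgeSet

/-! Choosing vertices of large degree inside successive neighbourhoods shows that a positive
proportion of all `n ^ v_H` tuples are ordered cliques of `F` (`exists_card_orderedCliques_ge`), and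
each of them carries a copy of `H`. The bound on `p > 0` gives `n ^ (v_H - v_J) * p ^ (e_H - e_J) ≤
1` for all admissible `J`. Hence, for a fixed copy with edge set `A`, the sum of `p ^ #(B \ A)` over
copies `B` sharing an edge with it is at most a constant (`sum_pow_card_imageEdges_sdiff_le`).

Under such a bound, `M` sets of size `e` are all avoided with probability at most `(1 - c * p ^ e) ^
M` (`randomSum_avoids_le`). To obtain many disjoint sets instead of one, take a largest disjoint
subfamily `𝓓` inside the random set: every member disjoint from its union is avoided. If `𝓓` is
small, at least half of all members are of this kind, and a union bound over small `𝓓` gives an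
exponentially small failure probability (`randomSum_no_disjoint_subfamily_le`). -/

/-! ### Random subsets: conditioning, Harris' inequality, a Janson-type bound. -/

/-- The expectation of `f` at the random subset of `u` that contains each element independently with
probability `p`. -/
noncomputable def Finset.randomSum {α : Type*} [DecidableEq α] (u : Finset α) (p : ℝ)
    (f : Finset α → ℝ) : ℝ :=
  ∑ S ∈ u.powerset, p ^ #S * (1 - p) ^ #(u \ S) * f S

/-- The indicator of the event that `S` contains none of the sets `D j` with `j ∈ s`. -/
def Finset.avoids {α ι : Type*} [DecidableEq α] (s : Finset ι) (D : ι → Finset α)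
    (S : Finset α) : ℝ :=
  ∏ j ∈ s, if D j ⊆ S then 0 else 1

namespace Finset

variable {α ι : Type*} [DecidableEq α] {u : Finset α} {p : ℝ} {f g : Finset α → ℝ}

lemma randomSum_const_one (u : Finset α) (p : ℝ) : u.randomSum p (fun _ => 1) = 1 := by
  have h := Finset.sum_pow_mul_eq_add_pow p (1 - p) u
  simp only [add_sub_cancel, one_pow] at h
  refine Eq.trans (Finset.sum_congr rfl fun S hS => ?_) h
  rw [card_sdiff_of_subset (mem_powerset.1 hS), mul_one]

lemma randomSum_sub (f g : Finset α → ℝ) :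
    u.randomSum p (fun S => f S - g S) = u.randomSum p f - u.randomSum p g := by
  simp only [randomSum, mul_sub, sum_sub_distrib]

lemma randomSum_sum (s : Finset ι) (f : ι → Finset α → ℝ) :
    u.randomSum p (fun S => ∑ i ∈ s, f i S) = ∑ i ∈ s, u.randomSum p (f i) := by
  simp only [randomSum, mul_sum]
  exact sum_comm

lemma randomSum_mono (hp₀ : 0 ≤ p) (hp₁ : p ≤ 1) (h : ∀ S ⊆ u, f S ≤ g S) :
    u.randomSum p f ≤ u.randomSum p g := by
  have : 0 ≤ 1 - p := by linarith
  exact sum_le_sum fun S hS => mul_le_mul_of_nonneg_left (h S (mem_powerset.1 hS)) (by positivity)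

lemma randomSum_congr (h : ∀ S ⊆ u, f S = g S) : u.randomSum p f = u.randomSum p g :=
  sum_congr rfl fun S hS => by rw [h S (mem_powerset.1 hS)]

lemma randomSum_nonneg (hp₀ : 0 ≤ p) (hp₁ : p ≤ 1) (h : ∀ S, 0 ≤ f S) :
    0 ≤ u.randomSum p f := by
  have : 0 ≤ 1 - p := by linarith
  exact sum_nonneg fun S _ => mul_nonneg (by positivity) (h S)

lemma randomSum_mem {a : α} (ha : a ∈ u) (f : Finset α → ℝ) :
    u.randomSum p (fun S => if a ∈ S then f S else 0) =
      p * u.randomSum p (fun S => f (insert a S)) := by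
  obtain ⟨v, hav, rfl⟩ : ∃ v, a ∉ v ∧ u = insert a v :=
    ⟨u.erase a, notMem_erase a u, (insert_erase ha).symm⟩
  simp only [randomSum]
  rw [sum_powerset_insert hav, sum_powerset_insert hav, ← sum_add_distrib, ← sum_add_distrib,
    mul_sum]
  refine sum_congr rfl fun S hS => ?_
  have hS' := mem_powerset.1 hS
  have haS : a ∉ S := fun h => hav (hS' h)
  have h1 : insert a v \ S = insert a (v \ S) := insert_sdiff_of_notMem _ haS
  have h2 : insert a v \ insert a S = v \ S := by
    ext x; simp only [mem_sdiff, mem_insert]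
    constructor
    · tauto
    · rintro ⟨hx, hxS⟩
      exact ⟨Or.inr hx, by rintro (rfl | h); exacts [hav hx, hxS h]⟩
  have h3 : a ∉ v \ S := fun h => hav (mem_sdiff.1 h).1
  rw [h1, h2, card_insert_of_notMem h3, card_insert_of_notMem haS, if_neg haS,
    if_pos (mem_insert_self a S), insert_idem]
  ring

/-- Conditioning on `A ⊆ S`: the elements outside `A` stay independent, so the conditioned set is
distributed as `S ∪ A`. -/
lemma randomSum_subset {A : Finset α} (hA : A ⊆ u) (f : Finset α → ℝ) :
    u.randomSum p (fun S => if A ⊆ S then f S else 0) =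
      p ^ #A * u.randomSum p (fun S => f (S ∪ A)) := by
  induction A using Finset.induction_on generalizing f with
  | empty => simp
  | insert a A haA ih =>
    rw [insert_subset_iff] at hA
    have h1 : ∀ S : Finset α, (if insert a A ⊆ S then f S else 0) =
        if A ⊆ S then (if a ∈ S then f S else 0) else 0 := fun S => by
      simp only [insert_subset_iff]; split_ifs <;> tauto
    simp only [h1]
    rw [ih hA.2, card_insert_of_notMem haA, pow_succ, mul_assoc]
    have h2 : ∀ S : Finset α, (if a ∈ S ∪ A then f (S ∪ A) else 0) =
        if a ∈ S then f (S ∪ A) else 0 := fun S => by simp [haA]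
    simp only [h2]
    rw [randomSum_mem hA.1 (fun S => f (S ∪ A))]
    simp

/-- **Harris' inequality** for monotone functions. -/
lemma randomSum_mul_le_of_monotone [Fintype α] (hp₀ : 0 ≤ p) (hp₁ : p ≤ 1)
    (hf₀ : 0 ≤ f) (hg₀ : 0 ≤ g) (hf : Monotone f) (hg : Monotone g) :
    u.randomSum p f * u.randomSum p g ≤ u.randomSum p (fun S => f S * g S) := by
  have hq : 0 ≤ 1 - p := by linarith
  -- The weight is extended by zero outside `u`, so that the FKG inequality applies on the whole
  -- lattice. Being a product weight, it satisfies the lattice condition with equality inside `u`.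
  let μ : Finset α → ℝ := fun S => if S ⊆ u then p ^ #S * (1 - p) ^ #(u \ S) else 0
  have hsum : ∀ h : Finset α → ℝ, ∑ S, μ S * h S = u.randomSum p h := fun h => by
    simp only [randomSum, μ, ite_mul, zero_mul]
    rw [← sum_filter]
    exact sum_congr (by ext; simp) fun _ _ => rfl
  have hμ₀ : 0 ≤ μ := fun S => by simp only [μ]; split_ifs <;> simp; positivity
  have key := fkg f g μ hμ₀ hf₀ hg₀ hf hg fun S T => by
    by_cases hS : S ⊆ u
    · by_cases hT : T ⊆ u
      · have h1 : S ∩ T ⊆ u := inter_subset_left.trans hS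
        have h2 : S ∪ T ⊆ u := union_subset hS hT
        simp only [μ, hS, hT, h1, h2, if_true, inf_eq_inter, sup_eq_union]
        have c1 : #(S ∩ T) + #(S ∪ T) = #S + #T := card_inter_add_card_union S T
        have c2 : #(u \ (S ∩ T)) + #(u \ (S ∪ T)) = #(u \ S) + #(u \ T) := by
          rw [card_sdiff_of_subset hS, card_sdiff_of_subset hT, card_sdiff_of_subset h1,
            card_sdiff_of_subset h2]
          have := card_le_card hS
          have := card_le_card hT
          have := card_le_card h1
          have := card_le_card h2
          omega
        refine le_of_eq ?_
        calc _ = p ^ (#S + #T) * (1 - p) ^ (#(u \ S) + #(u \ T)) := by ring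
          _ = _ := by rw [← c1, ← c2]; ring
      · simpa [μ, hT] using mul_nonneg (hμ₀ (S ∩ T)) (hμ₀ (S ∪ T))
    · simpa [μ, hS] using mul_nonneg (hμ₀ (S ∩ T)) (hμ₀ (S ∪ T))
  have h1 : ∑ S, μ S = 1 := by
    have := hsum fun _ => 1
    simpa [randomSum_const_one] using this
  simpa only [hsum, h1, one_mul] using key

/-- **Harris' inequality** for antitone functions with values at most one. -/
lemma randomSum_mul_le_of_antitone [Fintype α] (hp₀ : 0 ≤ p) (hp₁ : p ≤ 1)
    (hf₁ : ∀ S, f S ≤ 1) (hg₁ : ∀ S, g S ≤ 1) (hf : Antitone f) (hg : Antitone g) :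
    u.randomSum p f * u.randomSum p g ≤ u.randomSum p (fun S => f S * g S) := by
  have key := randomSum_mul_le_of_monotone (u := u) (f := fun S => 1 - f S) (g := fun S => 1 - g S)
    hp₀ hp₁ (fun S => by simpa using hf₁ S) (fun S => by simpa using hg₁ S)
    (fun S T h => sub_le_sub_left (hf h) 1) (fun S T h => sub_le_sub_left (hg h) 1)
  have h : (fun S => (1 - f S) * (1 - g S)) = fun S => ((1 - f S) - (g S - f S * g S)) := by
    funext S; ring
  rw [h] at key
  simp only [randomSum_sub, randomSum_const_one] at key
  linarith

lemma avoids_nonneg (s : Finset ι) (D : ι → Finset α) (S : Finset α) : 0 ≤ s.avoids D S :=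
  prod_nonneg fun _ _ => by split_ifs <;> simp

lemma avoids_le_one (s : Finset ι) (D : ι → Finset α) (S : Finset α) : s.avoids D S ≤ 1 :=
  prod_le_one (fun _ _ => by split_ifs <;> simp) fun _ _ => by split_ifs <;> simp

lemma avoids_antitone (s : Finset ι) (D : ι → Finset α) : Antitone (s.avoids D) := by
  intro S T h
  refine prod_le_prod (fun _ _ => by split_ifs <;> simp) fun i _ => ?_
  by_cases h2 : D i ⊆ S
  · simp [h2, h2.trans h]
  · simp only [h2, if_false]
    split_ifs <;> simp

lemma avoids_eq_one {s : Finset ι} {D : ι → Finset α} {S : Finset α}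
    (h : ∀ j ∈ s, ¬ D j ⊆ S) : s.avoids D S = 1 :=
  prod_eq_one fun j hj => if_neg (h j hj)

lemma avoids_le_of_subset [DecidableEq ι] {s t : Finset ι} (h : s ⊆ t) (D : ι → Finset α)
    (S : Finset α) : t.avoids D S ≤ s.avoids D S :=
  prod_le_prod_of_subset_of_le_one h (fun _ _ => by split_ifs <;> simp)
    fun _ _ _ => by split_ifs <;> simp

lemma avoids_insert [DecidableEq ι] {s : Finset ι} {i : ι} (hi : i ∉ s) (D : ι → Finset α)
    (S : Finset α) :
    (insert i s).avoids D S = s.avoids D S - if D i ⊆ S then s.avoids D S else 0 := by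
  rw [avoids, prod_insert hi]
  split_ifs <;> simp [avoids]

/-- Avoiding `D j` is a decreasing event of probability `1 - p ^ #(D j)`, so Harris' inequality lets
these factors be split off one at a time. -/
lemma randomSum_mul_prod_le_avoids [Fintype α] (hp₀ : 0 ≤ p) (hp₁ : p ≤ 1)
    (hf₀ : ∀ S, 0 ≤ f S) (hf₁ : ∀ S, f S ≤ 1) (hf : Antitone f) (s : Finset ι) (D : ι → Finset α)
    (hD : ∀ j ∈ s, D j ⊆ u) :
    u.randomSum p f * ∏ j ∈ s, (1 - p ^ #(D j)) ≤ u.randomSum p (fun S => f S * s.avoids D S) := by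
  classical
  induction s using Finset.induction_on with
  | empty => simp [avoids]
  | insert i s hi ih =>
    have h1 : u.randomSum p (fun S => 1 - if D i ⊆ S then 1 else 0) = 1 - p ^ #(D i) := by
      rw [randomSum_sub, randomSum_const_one,
        randomSum_subset (hD i (mem_insert_self i s)) (fun _ => 1), randomSum_const_one, mul_one]
    have h2 := randomSum_mul_le_of_antitone (u := u) (f := fun S => f S * s.avoids D S)
      (g := fun S => 1 - if D i ⊆ S then 1 else 0) hp₀ hp₁
      (fun S => mul_le_one₀ (hf₁ S) (avoids_nonneg s D S) (avoids_le_one s D S))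
      (fun S => by split_ifs <;> simp)
      (fun S T h => mul_le_mul (hf h) (avoids_antitone s D h) (avoids_nonneg s D T) (hf₀ S))
      (fun S T h => by
        refine sub_le_sub_left ?_ 1
        by_cases h2 : D i ⊆ S
        · simp [h2, h2.trans h]
        · simp only [h2, if_false]
          split_ifs <;> simp)
    have h3 : (fun S => f S * (insert i s).avoids D S) =
        fun S => f S * s.avoids D S * (1 - if D i ⊆ S then 1 else 0) := by
      funext S
      rw [avoids_insert hi]
      split_ifs <;> ring
    have h4 : 0 ≤ 1 - p ^ #(D i) := sub_nonneg.2 (pow_le_one₀ hp₀ hp₁)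
    rw [prod_insert hi, h3]
    refine le_trans ?_ h2
    rw [h1]
    have := mul_le_mul_of_nonneg_right
      (ih fun j hj => hD j (mem_insert_of_mem hj)) h4
    linarith

lemma exp_neg_two_mul_le {x : ℝ} (hx₀ : 0 ≤ x) (hx : x ≤ 1 / 2) : Real.exp (-2 * x) ≤ 1 - x := by
  have h1 : 1 + 2 * x ≤ Real.exp (2 * x) := by linarith [Real.add_one_le_exp (2 * x)]
  have h2 : Real.exp (-2 * x) * Real.exp (2 * x) = 1 := by rw [← Real.exp_add]; simp
  have h3 : 0 < Real.exp (-2 * x) := Real.exp_pos _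
  nlinarith [mul_nonneg hx₀ (sub_nonneg.2 hx)]

/-- A Janson-type inequality: the probability that a random set contains no member of a family of
`e`-sets in which each member has bounded weighted degree. -/
lemma randomSum_avoids_le [Fintype α] {e : ℕ} {C : ℝ} (hp₀ : 0 ≤ p) (hp : p ≤ 1 / 2)
    (𝓗 : Finset (Finset α)) (hu : ∀ A ∈ 𝓗, A ⊆ u) (he : ∀ A ∈ 𝓗, #A = e)
    (hC : ∀ A ∈ 𝓗, ∑ B ∈ 𝓗 with ¬ Disjoint B A, p ^ #(B \ A) ≤ C) :
    u.randomSum p (𝓗.avoids id) ≤ (1 - Real.exp (-2 * C) * p ^ e) ^ #𝓗 := by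
  have hp₁ : p ≤ 1 := by linarith
  induction 𝓗 using Finset.induction_on with
  | empty => 
    have : (∅ : Finset (Finset α)).avoids id = fun _ => 1 := by funext S; simp [avoids]
    rw [this, randomSum_const_one, card_empty, pow_zero]
  | insert A 𝓛 hA ih =>
    have hmono : ∀ A ∈ 𝓛, ∑ B ∈ 𝓛 with ¬ Disjoint B A, p ^ #(B \ A) ≤ C := fun A' hA' =>
      (sum_le_sum_of_subset_of_nonneg (filter_subset_filter _ (subset_insert A 𝓛))
        fun _ _ _ => by positivity).trans (hC A' (mem_insert_of_mem hA'))
    have ih := ih (fun B hB => hu B (mem_insert_of_mem hB))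
      (fun B hB => he B (mem_insert_of_mem hB)) hmono
    have hC0 : 0 ≤ C :=
      (sum_nonneg fun _ _ => by positivity).trans (hC A (mem_insert_self A 𝓛))
    have hAe := he A (mem_insert_self A 𝓛)
    set c := Real.exp (-2 * C) with hc
    have hc1 : c ≤ 1 := Real.exp_le_one_iff.2 (by linarith)
    have hpe : p ^ e ≤ 1 := pow_le_one₀ hp₀ hp₁
    set E := u.randomSum p (𝓛.avoids id) with hE
    have hE0 : 0 ≤ E := randomSum_nonneg hp₀ hp₁ (avoids_nonneg _ _)
    -- Given `A ⊆ S`, members disjoint from `A` are unaffected, while a member `B` meeting `A`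
    -- shrinks to `B \ A`. By Harris the latter cost at most the factor `c`, so conditioning on `A ⊆
    -- S` keeps the avoidance probability at least `E * c`.
    set 𝓜 := 𝓛.filter fun B => ¬ Disjoint B A
    set 𝓓 := 𝓛.filter fun B => Disjoint B A
    have hprod : c ≤ ∏ B ∈ 𝓜, (1 - p ^ #(B \ A)) := by
      calc c ≤ Real.exp (∑ B ∈ 𝓜, -2 * p ^ #(B \ A)) := by
            rw [hc, Real.exp_le_exp, ← mul_sum]
            have := (sum_le_sum_of_subset_of_nonneg (f := fun B => p ^ #(B \ A))
              (filter_subset_filter (fun B => ¬ Disjoint B A) (subset_insert A 𝓛))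
              fun _ _ _ => by positivity).trans (hC A (mem_insert_self A 𝓛))
            linarith
        _ = ∏ B ∈ 𝓜, Real.exp (-2 * p ^ #(B \ A)) := Real.exp_sum _ _
        _ ≤ _ := prod_le_prod (fun _ _ => (Real.exp_pos _).le) fun B hB => by
            have hB' := (mem_filter.1 hB).1
            refine exp_neg_two_mul_le (by positivity) ?_
            -- Distinct sets of equal size: `B \ A` is nonempty, so its weight is at most `p ≤ 1 /
            -- 2`.
            have : #(B \ A) ≠ 0 := fun h => hA <| by
              have hBA : B ⊆ A := by simpa using h
              rwa [← eq_of_subset_of_card_le hBA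
                (by rw [hAe, he B (mem_insert_of_mem hB')])]
            exact (pow_le_of_le_one hp₀ hp₁ this).trans hp
    have hshift : E * c ≤ u.randomSum p (fun S => 𝓛.avoids id (S ∪ A)) := by
      calc E * c ≤ u.randomSum p (𝓓.avoids id) * ∏ B ∈ 𝓜, (1 - p ^ #(B \ A)) := by
            gcongr
            · exact randomSum_nonneg hp₀ hp₁ (avoids_nonneg _ _)
            · exact randomSum_mono hp₀ hp₁ fun S _ =>
                avoids_le_of_subset (filter_subset _ _) id S
        _ ≤ u.randomSum p (fun S => 𝓓.avoids id S * 𝓜.avoids (· \ A) S) :=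
            randomSum_mul_prod_le_avoids hp₀ hp₁ (avoids_nonneg _ _) (avoids_le_one _ _)
              (avoids_antitone _ _) _ _ fun B hB =>
                sdiff_subset.trans (hu B (mem_insert_of_mem (mem_filter.1 hB).1))
        _ = _ := randomSum_congr fun S _ => by
            rw [avoids, avoids, avoids, ← prod_filter_mul_prod_filter_not 𝓛 (fun B => Disjoint B A)]
            refine congrArg₂ _ (prod_congr rfl fun B hB => ?_) (prod_congr rfl fun B hB => ?_)
            · have hd := (mem_filter.1 hB).2
              simp only [id]
              congr 1
              exact propext ⟨fun h => h.trans subset_union_left,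
                fun h => hd.left_le_of_le_sup_right h⟩
            · simp only [id, sdiff_le_iff, ← sup_eq_union, sup_comm A S]
    have hexp : u.randomSum p ((insert A 𝓛).avoids id) =
        E - p ^ e * u.randomSum p (fun S => 𝓛.avoids id (S ∪ A)) := by
      rw [← hAe, ← randomSum_subset (hu A (mem_insert_self A 𝓛)), hE, ← randomSum_sub]
      exact randomSum_congr fun S _ => avoids_insert hA id S
    have hc0 : 0 ≤ 1 - c * p ^ e :=
      sub_nonneg.2 (mul_le_one₀ hc1 (by positivity) hpe)
    rw [hexp, card_insert_of_notMem hA, pow_succ]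
    calc _ ≤ E - p ^ e * (E * c) := by gcongr
      _ = E * (1 - c * p ^ e) := by ring
      _ ≤ _ := by gcongr

end Finset

/-! ### Lower tail for the largest disjoint subfamily. -/

namespace Finset

variable {α : Type*} [DecidableEq α] {u : Finset α} {p : ℝ}

/-- A lower tail bound for the largest disjoint subfamily of a family of `e`-sets all of whose
members lie in a random set. -/
lemma randomSum_no_disjoint_subfamily_le [Fintype α] {e : ℕ} {C t : ℝ} (hp₀ : 0 < p)
    (hp : p ≤ 1 / 2) (hC₀ : 0 ≤ C) (he₀ : e ≠ 0)
    (𝓗 : Finset (Finset α)) (hu : ∀ A ∈ 𝓗, A ⊆ u) (he : ∀ A ∈ 𝓗, #A = e)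
    (hC : ∀ A ∈ 𝓗, ∑ B ∈ 𝓗 with ¬ Disjoint B A, p ^ #(B \ A) ≤ C)
    (ht : t ≤ Real.exp (-2 * C) / (16 * (1 + C)) * (#𝓗 * p ^ e)) (P : Finset α → Prop)
    [DecidablePred P]
    (hP : ∀ S, P S → ∀ 𝓓 ⊆ 𝓗, (𝓓 : Set (Finset α)).PairwiseDisjoint id →
      (∀ A ∈ 𝓓, A ⊆ S) → (#𝓓 : ℝ) < t) :
    u.randomSum p (fun S => if P S then 1 else 0) ≤
      Real.exp (-(Real.exp (-2 * C) / 8) * (#𝓗 * p ^ e)) := by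
  have hp₁ : p ≤ 1 := by linarith
  set c := Real.exp (-2 * C) with hc
  have hc0 : 0 < c := Real.exp_pos _
  have hc1 : c ≤ 1 := Real.exp_le_one_iff.2 (by linarith)
  set M : ℝ := (#𝓗 : ℝ)
  have hM : 0 ≤ M := Nat.cast_nonneg _
  set q := p ^ e with hq
  have hq0 : 0 < q := by positivity
  have hq1 : q ≤ 1 := pow_le_one₀ hp₀.le hp₁
  let Q : Finset (Finset α) → Prop := fun 𝓓 =>
    (𝓓 : Set (Finset α)).PairwiseDisjoint id ∧ (#𝓓 : ℝ) < t
  let U : Finset (Finset α) → Finset α := fun 𝓓 => 𝓓.biUnion id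
  let 𝓡 : Finset (Finset α) → Finset (Finset α) := fun 𝓓 => 𝓗.filter fun B => Disjoint B (U 𝓓)
  classical
  -- Union bound: a maximum disjoint subfamily `𝓓` inside `S` is small by `hP`, and by maximality
  -- `S` avoids every member disjoint from its union.
  have hcover : ∀ S ⊆ u, (if P S then 1 else 0) ≤
      ∑ 𝓓 ∈ 𝓗.powerset with Q 𝓓, if U 𝓓 ⊆ S then (𝓡 𝓓).avoids id S else 0 := by
    intro S _
    have hnn : ∀ 𝓓 ∈ 𝓗.powerset.filter Q,
        0 ≤ if U 𝓓 ⊆ S then (𝓡 𝓓).avoids id S else 0 := fun 𝓓 _ => by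
      split_ifs
      exacts [avoids_nonneg _ _ _, le_rfl]
    split_ifs with hS
    · obtain ⟨𝓓, h𝓓, hmax⟩ := exists_max_image
        (𝓗.powerset.filter fun 𝓓 : Finset (Finset α) =>
          (𝓓 : Set (Finset α)).PairwiseDisjoint id ∧ ∀ A ∈ 𝓓, A ⊆ S)
        card ⟨∅, by simp⟩
      simp only [mem_filter, mem_powerset] at h𝓓 hmax
      obtain ⟨h𝓓H, hdis, hsub⟩ := h𝓓
      have hUS : U 𝓓 ⊆ S := biUnion_subset.2 hsub
      have hmem : 𝓓 ∈ 𝓗.powerset.filter Q :=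
        mem_filter.2 ⟨mem_powerset.2 h𝓓H, hdis, hP S hS 𝓓 h𝓓H hdis hsub⟩
      refine le_trans ?_ (single_le_sum hnn hmem)
      rw [if_pos hUS, avoids_eq_one]
      intro B hB hBS
      obtain ⟨hBH, hBU⟩ := mem_filter.1 hB
      have hBd : ∀ A ∈ 𝓓, Disjoint B A := fun A hA => (disjoint_biUnion_right _ _ _).1 hBU A hA
      -- A member of `𝓓` disjoint from the union would be disjoint from itself, hence empty; `e ≠ 0`
      -- excludes this.
      by_cases hBD : B ∈ 𝓓
      · have hB0 : B = ∅ := disjoint_self.1 (hBd B hBD)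
        exact he₀ (by rw [← he B hBH, hB0, card_empty])
      · have := hmax (insert B 𝓓) ⟨insert_subset hBH h𝓓H, by
            rw [coe_insert]
            exact hdis.insert fun A hA _ => hBd A hA,
          fun A hA => by
            rcases mem_insert.1 hA with rfl | hA
            exacts [hBS, hsub A hA]⟩
        rw [card_insert_of_notMem hBD] at this
        omega
    · exact sum_nonneg hnn
  have hterm : ∀ 𝓓 ∈ 𝓗.powerset.filter Q,
      u.randomSum p (fun S => if U 𝓓 ⊆ S then (𝓡 𝓓).avoids id S else 0) ≤
        q ^ #𝓓 * Real.exp (-(c / 2) * (M * q)) := by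
    intro 𝓓 h𝓓
    obtain ⟨h𝓓H, hdis, hcard⟩ := by simpa only [mem_filter, mem_powerset, Q] using h𝓓
    have hUu : U 𝓓 ⊆ u := biUnion_subset.2 fun A hA => hu A (h𝓓H hA)
    have hUc : #(U 𝓓) = e * #𝓓 := by
      rw [card_biUnion fun A hA B hB hAB => hdis hA hB hAB, mul_comm]
      exact sum_const_nat fun A hA => he A (h𝓓H hA)
    -- Since `q ≤ p ^ #(B \ A)`, the weighted degree bound also bounds the number of members meeting
    -- a given `A`, by `C / q`.
    have hlost : (#(𝓗.filter fun B => ¬ Disjoint B (U 𝓓)) : ℝ) * q ≤ #𝓓 * C := by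
      have hsub : 𝓗.filter (fun B => ¬ Disjoint B (U 𝓓)) ⊆
          𝓓.biUnion fun A => 𝓗.filter fun B => ¬ Disjoint B A := by
        intro B hB
        obtain ⟨hB, hB'⟩ := mem_filter.1 hB
        simp only [U, disjoint_biUnion_right, not_forall] at hB'
        obtain ⟨A, hA, hBA⟩ := hB'
        exact mem_biUnion.2 ⟨A, hA, mem_filter.2 ⟨hB, hBA⟩⟩
      have h1 : (#(𝓗.filter fun B => ¬ Disjoint B (U 𝓓)) : ℝ) ≤
          ∑ A ∈ 𝓓, (#(𝓗.filter fun B => ¬ Disjoint B A) : ℝ) := by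
        exact_mod_cast (card_le_card hsub).trans card_biUnion_le
      calc _ ≤ (∑ A ∈ 𝓓, (#(𝓗.filter fun B => ¬ Disjoint B A) : ℝ)) * q := by gcongr
        _ = ∑ A ∈ 𝓓, ∑ B ∈ 𝓗 with ¬ Disjoint B A, q := by simp [sum_mul]
        _ ≤ ∑ A ∈ 𝓓, ∑ B ∈ 𝓗 with ¬ Disjoint B A, p ^ #(B \ A) := by
            refine sum_le_sum fun A _ => sum_le_sum fun B hB => ?_
            refine pow_le_pow_of_le_one hp₀.le hp₁ ?_
            rw [← he B (mem_filter.1 hB).1]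
            exact card_le_card sdiff_subset
        _ ≤ ∑ A ∈ 𝓓, C := sum_le_sum fun A hA => hC A (h𝓓H hA)
        _ = _ := by simp
    have hR : M / 2 ≤ (#(𝓡 𝓓) : ℝ) := by
      have h2 : (#(𝓡 𝓓) : ℝ) + #(𝓗.filter fun B => ¬ Disjoint B (U 𝓓)) = M := by
        rw [← Nat.cast_add]
        exact congrArg _ (card_filter_add_card_filter_not (s := 𝓗) fun B => Disjoint B (U 𝓓))
      have h3 : (#𝓓 : ℝ) * C ≤ M * q / 2 := by
        have : (#𝓓 : ℝ) ≤ c / (16 * (1 + C)) * (M * q) := hcard.le.trans ht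
        calc (#𝓓 : ℝ) * C ≤ c / (16 * (1 + C)) * (M * q) * C := by gcongr
          _ = (c * (C / (1 + C))) * (M * q / 16) := by field_simp
          _ ≤ (1 * 1) * (M * q / 16) := by
              gcongr
              exact (div_le_one (by linarith)).2 (by linarith)
          _ ≤ _ := by nlinarith [mul_nonneg hM hq0.le]
      have h4 : (M - #(𝓡 𝓓)) * q ≤ (M / 2) * q := by
        have : M - #(𝓡 𝓓) = #(𝓗.filter fun B => ¬ Disjoint B (U 𝓓)) := by linarith
        rw [this]
        linarith
      linarith [le_of_mul_le_mul_right h4 hq0]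
    have hJ := randomSum_avoids_le (u := u) hp₀.le hp (𝓡 𝓓)
      (fun A hA => hu A (mem_filter.1 hA).1) (fun A hA => he A (mem_filter.1 hA).1) (C := C)
      fun A hA => (sum_le_sum_of_subset_of_nonneg
        (filter_subset_filter _ (filter_subset _ 𝓗)) fun _ _ _ => by positivity).trans
          (hC A (mem_filter.1 hA).1)
    rw [randomSum_subset hUu, hUc, pow_mul]
    refine mul_le_mul_of_nonneg_left ?_ (by positivity)
    have hcq : c * q ≤ 1 := mul_le_one₀ hc1 hq0.le hq1
    calc _ ≤ u.randomSum p ((𝓡 𝓓).avoids id) :=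
          randomSum_mono hp₀.le hp₁ fun S _ => avoids_antitone _ _ subset_union_left
      _ ≤ (1 - c * q) ^ #(𝓡 𝓓) := hJ
      _ ≤ Real.exp (-(c * q)) ^ #(𝓡 𝓓) := by
          refine pow_le_pow_left₀ (by linarith) ?_ _
          linarith [Real.add_one_le_exp (-(c * q))]
      _ = Real.exp (-(c * q) * #(𝓡 𝓓)) := by rw [← Real.exp_nat_mul, mul_comm]
      _ ≤ _ := by
          rw [Real.exp_le_exp]
          nlinarith [mul_le_mul_of_nonneg_left hR (mul_pos hc0 hq0).le]
  -- This makes `exp (-L) = c * exp (-2) ≤ c / 4`, and `L = 2 * (1 + C)` cancels the denominator in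
  -- the bound on `t`. The final exponent is then `c / 8 + c / 4 - c / 2 = -c / 8` times `M * q`.
  set L := 2 * C + 2 with hL
  set x := Real.exp (-L) with hx
  have hxc : x ≤ c / 4 := by
    have h1 : Real.exp (-L) = c * Real.exp (-2) := by rw [hc, ← Real.exp_add]; congr 1; linarith
    have h2 : Real.exp (-2) ≤ 1 / 4 := by
      have h3 : (2 : ℝ) ≤ Real.exp 1 := by linarith [Real.add_one_le_exp (1 : ℝ)]
      have h4 : Real.exp (-2) * (Real.exp 1 * Real.exp 1) = 1 := by
        rw [← Real.exp_add, ← Real.exp_add]; norm_num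
      have := Real.exp_pos (-2)
      nlinarith [mul_le_mul h3 h3 (by norm_num) (by linarith)]
    rw [hx, h1]
    nlinarith
  -- Exponential tilting: `#𝓓 < t` gives `1 ≤ exp (L * (t - #𝓓))`, after which the size restriction
  -- is dropped and the binomial theorem sums over all subfamilies.
  have hsum : ∑ 𝓓 ∈ 𝓗.powerset with Q 𝓓, q ^ #𝓓 ≤
      Real.exp (t * L) * Real.exp (x * (M * q)) := by
    calc ∑ 𝓓 ∈ 𝓗.powerset with Q 𝓓, q ^ #𝓓
        ≤ ∑ 𝓓 ∈ 𝓗.powerset with Q 𝓓, Real.exp (t * L) * (x * q) ^ #𝓓 := by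
          refine sum_le_sum fun 𝓓 h𝓓 => ?_
          have hcard := (mem_filter.1 h𝓓).2.2
          rw [mul_pow, ← mul_assoc, hx, ← Real.exp_nat_mul, ← Real.exp_add]
          refine le_mul_of_one_le_left (by positivity) (Real.one_le_exp ?_)
          nlinarith
      _ ≤ ∑ 𝓓 ∈ 𝓗.powerset, Real.exp (t * L) * (x * q) ^ #𝓓 :=
          sum_le_sum_of_subset_of_nonneg (filter_subset _ _) fun _ _ _ => by positivity
      _ = Real.exp (t * L) * (x * q + 1) ^ #𝓗 := by
          rw [← mul_sum, ← sum_pow_mul_eq_add_pow]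
          simp
      _ ≤ Real.exp (t * L) * Real.exp (x * q) ^ #𝓗 := by
          gcongr
          exact Real.add_one_le_exp _
      _ = _ := by
          rw [← Real.exp_nat_mul]
          congr 2
          ring
  have htL : t * L ≤ c / 8 * (M * q) := by
    calc t * L ≤ c / (16 * (1 + C)) * (M * q) * L := by gcongr
      _ = _ := by rw [hL]; field_simp; ring
  calc _ ≤ ∑ 𝓓 ∈ 𝓗.powerset with Q 𝓓,
        u.randomSum p (fun S => if U 𝓓 ⊆ S then (𝓡 𝓓).avoids id S else 0) := by
        rw [← randomSum_sum]
        exact randomSum_mono hp₀.le hp₁ hcover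
    _ ≤ (∑ 𝓓 ∈ 𝓗.powerset with Q 𝓓, q ^ #𝓓) * Real.exp (-(c / 2) * (M * q)) := by
        rw [sum_mul]
        exact sum_le_sum hterm
    _ ≤ Real.exp (t * L) * Real.exp (x * (M * q)) * Real.exp (-(c / 2) * (M * q)) := by gcongr
    _ ≤ _ := by
        rw [← Real.exp_add, ← Real.exp_add, Real.exp_le_exp]
        nlinarith [mul_le_mul_of_nonneg_right hxc (mul_nonneg hM hq0.le)]

end Finset

/-! ### Counting cliques in locally dense graphs. -/

namespace SimpleGraph

lemma sum_card_adj_eq_twice_ncard_edgeSet_induce {W : Type*} (F : SimpleGraph W) [DecidableRel F.Adj]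
    (S : Finset W) :
    ∑ v ∈ S, #(S.filter (F.Adj v)) = 2 * (F.induce (S : Set W)).edgeSet.ncard := by
  rw [← coe_edgeFinset, Set.ncard_coe_finset, ← sum_degrees_eq_twice_card_edges,
    ← Finset.sum_coe_sort]
  refine Finset.sum_congr rfl fun v _ => ?_
  rw [← card_neighborFinset_eq_degree, ← Finset.card_map (Function.Embedding.subtype _)]
  congr 1
  ext w
  simp [and_comm]

variable {W : Type*} [Fintype W]

/-- The maps from `Fin k` to `T` whose values are pairwise adjacent. -/
noncomputable def orderedCliques (F : SimpleGraph W) (T : Finset W) (k : ℕ) :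
    Finset (Fin k → W) :=
  open Classical in
  Finset.univ.filter fun f => (∀ i, f i ∈ T) ∧ ∀ i j, i ≠ j → F.Adj (f i) (f j)

lemma mem_orderedCliques {F : SimpleGraph W} {T : Finset W} {k : ℕ} {f : Fin k → W} :
    f ∈ F.orderedCliques T k ↔ (∀ i, f i ∈ T) ∧ ∀ i j, i ≠ j → F.Adj (f i) (f j) := by
  simp [orderedCliques]

/-- Prepending `v` to a clique in its neighbourhood is injective on pairs. -/
lemma sum_card_orderedCliques_le [DecidableEq W] (F : SimpleGraph W) [DecidableRel F.Adj] (T : Finset W) (k : ℕ)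
    {G : Finset W} (hG : G ⊆ T) :
    ∑ v ∈ G, #(F.orderedCliques (T.filter (F.Adj v)) k) ≤ #(F.orderedCliques T (k + 1)) := by
  rw [← Finset.card_sigma]
  refine Finset.card_le_card_of_injOn (fun x => Fin.cons x.1 x.2) ?_ ?_
  · rintro ⟨v, f⟩ h
    obtain ⟨hv, hf⟩ := Finset.mem_sigma.1 h
    obtain ⟨hf1, hf2⟩ := mem_orderedCliques.1 hf
    simp only [Finset.mem_filter] at hf1
    refine mem_orderedCliques.2 ⟨fun i => ?_, fun i j hij => ?_⟩
    · refine Fin.cases ?_ (fun i => ?_) i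
      · simpa using hG hv
      · simpa using (hf1 i).1
    · revert hij
      refine Fin.cases ?_ (fun i => ?_) i <;> refine Fin.cases ?_ (fun j => ?_) j
      · simp
      · intro _
        simpa using (hf1 j).2
      · intro _
        simpa using (hf1 i).2.symm
      · intro hij
        simpa using hf2 i j fun h => hij (by rw [h])
  · rintro ⟨v, f⟩ _ ⟨w, g⟩ _ h
    obtain ⟨rfl, rfl⟩ := Fin.cons_inj.1 h
    rfl

/-- In a graph all of whose large induced subgraphs are dense, a positive proportion of the
`k`-tuples of vertices are cliques. -/
lemma exists_card_orderedCliques_ge {d : ℝ} (hd₀ : 0 < d) (k : ℕ) :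
    ∃ (ρ c m : ℝ), 0 < ρ ∧ 0 < c ∧ ∀ {W : Type} [Fintype W] (F : SimpleGraph W)
      (T : Finset W), (∀ S ⊆ T, ρ * #T ≤ #S →
        d * ((#S).choose 2 : ℝ) ≤ ((F.induce (S : Set W)).edgeSet.ncard : ℝ)) → m ≤ #T →
      c * (#T : ℝ) ^ k ≤ #(F.orderedCliques T k) := by
  classical
  induction k with
  | zero =>
    refine ⟨1, 1, 0, one_pos, one_pos, fun F T _ _ => ?_⟩
    have : Fin.elim0 ∈ F.orderedCliques T 0 :=
      mem_orderedCliques.2 ⟨fun i => i.elim0, fun i => i.elim0⟩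
    simpa using Finset.card_pos.2 ⟨_, this⟩
  | succ k ih =>
    obtain ⟨ρ, c, m, hρ, hc, ih⟩ := ih
    -- The entry `1` lets density be applied to `T` itself, and `ρ * (d / 4)` passes it to
    -- neighbourhoods of size at least `d / 4 * t`. The entry `2` gives `t - 1 ≥ t / 2`; `m / (d /
    -- 4)` keeps those neighbourhoods large enough for induction.
    refine ⟨min 1 (ρ * (d / 4)), c * (d / 4) ^ (k + 1), max 2 (m / (d / 4)), by positivity,
      by positivity, fun {W} _ F T hT hm => ?_⟩
    set t : ℝ := (#T : ℝ) with ht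
    have ht2 : 2 ≤ t := (le_max_left _ _).trans hm
    have htm : m ≤ d / 4 * t := by
      have := (le_max_right _ _).trans hm
      rwa [div_le_iff₀' (by positivity)] at this
    have ht0 : 0 < t := by linarith
    let N : W → Finset W := fun v => T.filter (F.Adj v)
    let G := T.filter fun v => d / 4 * t ≤ #(N v)
    have hGT : G ⊆ T := Finset.filter_subset _ _
    have hsum : d * (t * (t - 1)) ≤ ∑ v ∈ T, (#(N v) : ℝ) := by
      have h1 := hT T subset_rfl (by
        nlinarith [min_le_left 1 (ρ * (d / 4))])
      have h2 : ∑ v ∈ T, (#(N v) : ℝ) = 2 * ((F.induce (T : Set W)).edgeSet.ncard : ℝ) := by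
        exact_mod_cast F.sum_card_adj_eq_twice_ncard_edgeSet_induce T
      rw [Nat.cast_choose_two] at h1
      rw [h2]
      linarith
    have hsum' : ∑ v ∈ T, (#(N v) : ℝ) ≤ #G * t + t * (d / 4 * t) := by
      rw [← Finset.sum_filter_add_sum_filter_not T fun v => d / 4 * t ≤ #(N v)]
      refine add_le_add ?_ ?_
      · rw [← nsmul_eq_mul]
        refine Finset.sum_le_card_nsmul _ _ _ fun v _ => ?_
        exact Nat.cast_le.2 (Finset.card_le_card (Finset.filter_subset _ T))
      · calc _ ≤ ∑ v ∈ T.filter fun v => ¬ d / 4 * t ≤ #(N v), d / 4 * t :=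
              Finset.sum_le_sum fun v hv => (not_le.1 (Finset.mem_filter.1 hv).2).le
          _ ≤ ∑ v ∈ T, d / 4 * t :=
              Finset.sum_le_sum_of_subset_of_nonneg (Finset.filter_subset _ _)
                fun _ _ _ => by positivity
          _ = _ := by simp [ht]
    -- Degrees sum to at least `d * t ^ 2 / 2`, and vertices outside `G` contribute at most half of
    -- this.
    have hG : d / 4 * t ≤ #G := by
      have h3 : d * (t * (t / 2)) ≤ d * (t * (t - 1)) := by gcongr; linarith
      have h4 : (d / 4 * t) * t ≤ #G * t := by nlinarith
      exact le_of_mul_le_mul_right h4 ht0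
    have hN : ∀ v ∈ G, c * (d / 4 * t) ^ k ≤ (#(F.orderedCliques (N v) k) : ℝ) := by
      intro v hv
      have hv' : d / 4 * t ≤ #(N v) := (Finset.mem_filter.1 hv).2
      refine le_trans ?_ (ih F (N v) (fun S hS hSc => hT S (hS.trans (Finset.filter_subset _ _)) ?_)
        (htm.trans hv'))
      · gcongr
      · calc _ ≤ ρ * (d / 4) * t := by gcongr; exact min_le_right _ _
          _ = ρ * (d / 4 * t) := by ring
          _ ≤ ρ * #(N v) := by gcongr
          _ ≤ _ := hSc
    calc c * (d / 4) ^ (k + 1) * t ^ (k + 1) = (d / 4 * t) * (c * (d / 4 * t) ^ k) := by ring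
      _ ≤ #G * (c * (d / 4 * t) ^ k) := by gcongr
      _ = ∑ v ∈ G, c * (d / 4 * t) ^ k := by simp
      _ ≤ ∑ v ∈ G, (#(F.orderedCliques (N v) k) : ℝ) := Finset.sum_le_sum hN
      _ ≤ _ := by exact_mod_cast F.sum_card_orderedCliques_le T k hGT

end SimpleGraph

/-! ### Overlaps of copies of `H` and the role of `m*(H)`. -/

namespace SimpleGraph

variable {V W : Type*} [Fintype V]

/-- The edges of the image of `H` under `f`. -/
noncomputable def imageEdges (H : SimpleGraph V) (f : V → W) : Finset (Sym2 W) :=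
  open Classical in H.edgeFinset.image (Sym2.map f)

lemma coe_imageEdges (H : SimpleGraph V) (f : V → W) :
    (H.imageEdges f : Set (Sym2 W)) = Sym2.map f '' H.edgeSet := by
  simp [imageEdges]

lemma mem_imageEdges {H : SimpleGraph V} {f : V → W} {z : Sym2 W} :
    z ∈ H.imageEdges f ↔ ∃ e ∈ H.edgeSet, Sym2.map f e = z := by
  rw [← Finset.mem_coe, coe_imageEdges, Set.mem_image]

lemma card_imageEdges (H : SimpleGraph V) {f : V → W} (hf : Function.Injective f) :
    #(H.imageEdges f) = H.edgeSet.ncard := by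
  rw [← Set.ncard_coe_finset, coe_imageEdges,
    Set.ncard_image_of_injective _ (Sym2.map.injective hf)]

lemma mem_range_of_mem_imageEdges {H : SimpleGraph V} {f : V → W} {a b : W}
    (h : s(a, b) ∈ H.imageEdges f) : a ∈ Set.range f ∧ b ∈ Set.range f := by
  obtain ⟨e, -, he⟩ := mem_imageEdges.1 h
  induction e with | _ x y
  rw [Sym2.map_mk, Sym2.eq_iff] at he
  rcases he with ⟨rfl, rfl⟩ | ⟨rfl, rfl⟩ <;> simp

/-- If every proper subgraph `J` of `H` has at most as many extensions to a copy of `H` as expected,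
then the overlaps of a given copy of `H` with all copies of `H` have bounded weight. -/
lemma sum_pow_card_imageEdges_sdiff_le [Fintype W] [DecidableEq W] (H : SimpleGraph V) {p : ℝ}
    (hp₀ : 0 ≤ p) (hp₁ : p ≤ 1)
    (hJ : ∀ J : H.Subgraph, 2 ≤ J.verts.ncard → J.verts.ncard < Fintype.card V →
      (Fintype.card W : ℝ) ^ (Fintype.card V - J.verts.ncard) *
        p ^ (H.edgeSet.ncard - J.edgeSet.ncard) ≤ 1)
    (g : V → W) (I : Finset (V → W)) (hI : ∀ f ∈ I, Function.Injective f) :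
    ∑ f ∈ I with ¬ Disjoint (H.imageEdges f) (H.imageEdges g),
      p ^ #(H.imageEdges f \ H.imageEdges g) ≤ (Fintype.card V + 1 : ℝ) ^ Fintype.card V := by
  classical
  set X := I.filter fun f => ¬ Disjoint (H.imageEdges f) (H.imageEdges g)
  -- The overlap pattern: which vertex of `g`, if any, each vertex is glued to. There are `(v_H + 1)
  -- ^ v_H` patterns, and each will contribute at most `1`.
  let π : (V → W) → V → Option V := fun f x =>
    if h : ∃ y, g y = f x then some h.choose else none
  have hπ : ∀ f x y, π f x = some y → f x = g y := by
    intro f x y h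
    simp only [π] at h
    split_ifs at h with h'
    obtain rfl := Option.some.inj h
    exact h'.choose_spec.symm
  have hπ' : ∀ f x, f x ∈ Set.range g → π f x ≠ none := by
    rintro f x h
    have h' : ∃ y, g y = f x := h
    simp [π, h']
  have hfib : ∀ φ : V → Option V,
      ∑ f ∈ X with π f = φ, p ^ #(H.imageEdges f \ H.imageEdges g) ≤ 1 := by
    intro φ
    rcases (X.filter fun f => π f = φ).eq_empty_or_nonempty with h0 | ⟨f₀, hf₀⟩
    · rw [h0]; simp
    obtain ⟨hf₀X, hf₀φ⟩ := Finset.mem_filter.1 hf₀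
    -- The part of `H` glued to `g`. All maps of one pattern agree on its vertices, so only `v_H -
    -- v_J` vertices are free, and at least `e_H - e_J` edges are new.
    let J : H.Subgraph :=
      { verts := {x | φ x ≠ none}
        Adj := fun x y => H.Adj x y ∧ s(f₀ x, f₀ y) ∈ H.imageEdges g
        adj_sub := fun h => h.1
        edge_vert := fun {x y} h => by
          have := hπ' f₀ x (mem_range_of_mem_imageEdges h.2).1
          rwa [hf₀φ] at this
        symm := ⟨fun x y h => ⟨h.1.symm, by rw [Sym2.eq_swap]; exact h.2⟩⟩ }
    have hagree : ∀ f, π f = φ → ∀ x ∈ J.verts, f x = f₀ x := by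
      intro f hf x hx
      obtain ⟨y, hy⟩ := Option.ne_none_iff_exists'.1 (show φ x ≠ none from hx)
      rw [hπ f x y (by rw [hf, hy]), hπ f₀ x y (by rw [hf₀φ, hy])]
    have hverts : ∀ f, π f = φ → ∀ x y, s(f x, f y) ∈ H.imageEdges g →
        x ∈ J.verts ∧ y ∈ J.verts := by
      intro f hf x y h
      have h1 := mem_range_of_mem_imageEdges h
      have h2 := hπ' f x h1.1
      have h3 := hπ' f y h1.2
      rw [hf] at h2 h3
      exact ⟨h2, h3⟩
    have hedge : ∀ f ∈ X.filter (fun f => π f = φ),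
        H.edgeSet.ncard - J.edgeSet.ncard ≤ #(H.imageEdges f \ H.imageEdges g) := by
      intro f hf
      obtain ⟨hfX, hfφ⟩ := Finset.mem_filter.1 hf
      have hfI := hI f (Finset.mem_filter.1 hfX).1
      have h1 : #(H.imageEdges f ∩ H.imageEdges g) ≤ J.edgeSet.ncard := by
        rw [← Set.ncard_coe_finset]
        refine (Set.ncard_le_ncard (t := Sym2.map f '' J.edgeSet) ?_ (Set.toFinite _)).trans
          (Set.ncard_image_le (Set.toFinite _))
        intro z hz
        obtain ⟨hzf, hzg⟩ := Finset.mem_inter.1 (Finset.mem_coe.1 hz)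
        obtain ⟨e, he, rfl⟩ := mem_imageEdges.1 hzf
        refine ⟨e, ?_, rfl⟩
        induction e with | _ x y
        rw [Sym2.map_mk] at hzg
        obtain ⟨hx, hy⟩ := hverts f hfφ x y hzg
        refine ⟨he, ?_⟩
        rwa [← hagree f hfφ x hx, ← hagree f hfφ y hy]
      have h2 := Finset.card_sdiff_add_card_inter (H.imageEdges f) (H.imageEdges g)
      rw [H.card_imageEdges hfI] at h2
      omega
    have hfix : Fintype.card V - J.verts.ncard = Fintype.card {x // φ x = none} := by
      have h1 : J.verts.ncard = Fintype.card {x // ¬ φ x = none} := by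
        rw [← Nat.card_eq_fintype_card]; rfl
      have h2 := Fintype.card_subtype_compl fun x => φ x = none
      have h3 := Fintype.card_subtype_le fun x => φ x = none
      omega
    have hcard : #(X.filter fun f => π f = φ) ≤
        Fintype.card W ^ (Fintype.card V - J.verts.ncard) := by
      rw [hfix, ← Fintype.card_fun, ← Finset.card_univ]
      refine Finset.card_le_card_of_injOn (fun f (x : {x // φ x = none}) => f x) (by simp) ?_
      intro f hf f' hf' h
      funext x
      by_cases hx : φ x = none
      · exact congrFun h ⟨x, hx⟩
      · rw [hagree f (Finset.mem_filter.1 hf).2 x hx, hagree f' (Finset.mem_filter.1 hf').2 x hx]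
    have hv2 : 2 ≤ J.verts.ncard := by
      obtain ⟨z, hzf, hzg⟩ := Finset.not_disjoint_iff.1 (Finset.mem_filter.1 hf₀X).2
      obtain ⟨e, he, rfl⟩ := mem_imageEdges.1 hzf
      induction e with | _ x y
      obtain ⟨hx, hy⟩ := hverts f₀ hf₀φ x y hzg
      rw [← Set.ncard_pair (H.ne_of_adj he)]
      exact Set.ncard_le_ncard (Set.insert_subset hx (Set.singleton_subset_iff.2 hy))
        (Set.toFinite _)
    have hv : J.verts.ncard ≤ Fintype.card V := by
      rw [← Nat.card_eq_fintype_card, ← Set.ncard_univ]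
      exact Set.ncard_le_ncard (Set.subset_univ _) (Set.toFinite _)
    calc _ ≤ ∑ f ∈ X with π f = φ, p ^ (H.edgeSet.ncard - J.edgeSet.ncard) :=
          Finset.sum_le_sum fun f hf => pow_le_pow_of_le_one hp₀ hp₁ (hedge f hf)
      _ = #(X.filter fun f => π f = φ) * p ^ (H.edgeSet.ncard - J.edgeSet.ncard) := by simp
      _ ≤ (Fintype.card W : ℝ) ^ (Fintype.card V - J.verts.ncard) *
            p ^ (H.edgeSet.ncard - J.edgeSet.ncard) := by
          gcongr
          exact_mod_cast hcard
      _ ≤ 1 := by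
          -- The case `v_J = v_H` lies outside `hJ`, but then no vertex is free and the bound is
          -- trivial.
          rcases hv.lt_or_eq with hlt | heq
          · exact hJ J hv2 hlt
          · rw [heq, Nat.sub_self, pow_zero, one_mul]
            exact pow_le_one₀ hp₀ hp₁
  rw [← Finset.sum_fiberwise X π]
  calc _ ≤ ∑ φ : V → Option V, (1 : ℝ) := Finset.sum_le_sum fun φ _ => hfib φ
    _ = _ := by simp

lemma ncard_edgeSet_subgraph_le (H : SimpleGraph V) (J : H.Subgraph) :
    J.edgeSet.ncard ≤ H.edgeSet.ncard :=
  Set.ncard_le_ncard J.edgeSet_subset (Set.toFinite _)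

lemma mStar_nonneg (H : SimpleGraph V) (hV : 3 ≤ Fintype.card V) : 0 ≤ H.mStar := by
  obtain ⟨J, -, h2, h⟩ := (H.isLeast_mStar hV).1
  rw [h]
  have h1 : (J.edgeSet.ncard : ℝ) ≤ H.edgeSet.ncard := by
    exact_mod_cast H.ncard_edgeSet_subgraph_le J
  have h3 : (J.verts.ncard : ℝ) ≤ Fintype.card V := by exact_mod_cast h2.le
  exact div_nonneg (by linarith) (by linarith)

/-- At edge probability at most `n ^ (-1 / m*(H))`, proper subgraphs of `H` have at most as many
extensions to a copy of `H` as expected. -/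
lemma pow_mul_pow_le_one_of_le_edgeProbBound (H : SimpleGraph V) (hV : 3 ≤ Fintype.card V) {n : ℕ}
    (hn : n ≠ 0) (hm : 0 < H.mStar) {p : ℝ} (hp₀ : 0 < p) (hp₁ : p ≤ 1)
    (hp : p ≤ H.edgeProbBound n) (J : H.Subgraph)
    (h2 : 2 ≤ J.verts.ncard) (hJ : J.verts.ncard < Fintype.card V) :
    (n : ℝ) ^ (Fintype.card V - J.verts.ncard) * p ^ (H.edgeSet.ncard - J.edgeSet.ncard) ≤ 1 := by
  have hle := (H.isLeast_mStar hV).2 ⟨J, h2, hJ, rfl⟩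
  rw [edgeProbBound, if_neg hm.ne'] at hp
  have hn0 : (0 : ℝ) < n := by positivity
  rw [← Nat.cast_sub hJ.le, ← Nat.cast_sub (H.ncard_edgeSet_subgraph_le J)] at hle
  set a := Fintype.card V - J.verts.ncard
  set r := H.edgeSet.ncard - J.edgeSet.ncard
  have ha : (0 : ℝ) < a := by exact_mod_cast (Nat.sub_pos_of_lt hJ)
  rw [le_div_iff₀ ha] at hle
  -- Minimality gives `m* * a ≤ r`; as `p ≤ 1`, the exponent may be lowered to `m* * a`, where the
  -- bound on `p` yields exactly `n ^ (-a)`.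
  have h3 : p ^ r ≤ (n : ℝ) ^ (-(a : ℝ)) := by
    calc p ^ r = p ^ (r : ℝ) := (Real.rpow_natCast p r).symm
      _ ≤ p ^ (H.mStar * a) := Real.rpow_le_rpow_of_exponent_ge hp₀ hp₁ hle
      _ ≤ ((n : ℝ) ^ (-1 / H.mStar)) ^ (H.mStar * a) :=
          Real.rpow_le_rpow hp₀.le hp (by positivity)
      _ = _ := by
          rw [← Real.rpow_mul hn0.le]
          congr 1
          field_simp
  calc (n : ℝ) ^ a * p ^ r ≤ (n : ℝ) ^ a * (n : ℝ) ^ (-(a : ℝ)) := by gcongr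
    _ = 1 := by rw [← Real.rpow_natCast, ← Real.rpow_add hn0]; simp

lemma edgeProbBound_le_half (H : SimpleGraph V) (hm : 0 < H.mStar) {n : ℕ}
    (hn : (2 : ℝ) ^ H.mStar ≤ n) : H.edgeProbBound n ≤ 1 / 2 := by
  rw [edgeProbBound, if_neg hm.ne']
  calc (n : ℝ) ^ (-1 / H.mStar) ≤ ((2 : ℝ) ^ H.mStar) ^ (-1 / H.mStar) :=
        Real.rpow_le_rpow_of_nonpos (by positivity) hn
          (div_nonpos_of_nonpos_of_nonneg (by norm_num) hm.le)
    _ = (2 : ℝ) ^ (-1 : ℝ) := by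
        rw [← Real.rpow_mul (by norm_num)]
        congr 1
        field_simp
    _ = 1 / 2 := by rw [Real.rpow_neg_one]; norm_num

end SimpleGraph

/-! ### From random edge sets to the binomial random graph. -/

namespace SimpleGraph

instance {W : Type*} [Countable W] : MeasurableSingletonClass (SimpleGraph W) where
  measurableSet_singleton G := by
    have : {G} = edgeSet ⁻¹' {G.edgeSet} := by ext G'; simp
    rw [this]
    exact measurable_edgeSet (measurableSet_singleton _)

lemma binomialRandom_real_eq_randomSum {W : Type*} [Fintype W] [DecidableEq W] (p : unitInterval)
    (Φ : Set (SimpleGraph W)) [DecidablePred (· ∈ Φ)] :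
    (binomialRandom W p).real Φ =
      (Finset.univ.filter fun z : Sym2 W => ¬ z.IsDiag).randomSum p
        (fun S => if fromEdgeSet (S : Set (Sym2 W)) ∈ Φ then 1 else 0) := by
  classical
  have hsing : ∀ G : SimpleGraph W, (binomialRandom W p).real {G} =
      (p : ℝ) ^ #G.edgeFinset *
        (1 - p) ^ #((Finset.univ.filter fun z : Sym2 W => ¬ z.IsDiag) \ G.edgeFinset) := by
    intro G
    have h1 : G.edgeFinset ⊆ Finset.univ.filter fun z : Sym2 W => ¬ z.IsDiag := fun z hz => by
      simpa using G.not_isDiag_of_mem_edgeFinset hz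
    have h2 : #(Finset.univ.filter fun z : Sym2 W => ¬ z.IsDiag) = (Fintype.card W).choose 2 := by
      rw [← Sym2.card_subtype_not_diag, Fintype.card_subtype]
    rw [MeasureTheory.measureReal_def, binomialRandom_singleton, Finset.card_sdiff_of_subset h1, h2,
      Nat.card_eq_fintype_card, ← coe_edgeFinset, Set.ncard_coe_finset]
    simp
  have hΦ : (binomialRandom W p).real Φ =
      ∑ G ∈ Finset.univ.filter (· ∈ Φ), (binomialRandom W p).real {G} := by
    rw [MeasureTheory.sum_measureReal_singleton]
    simp
  rw [hΦ, Finset.sum_filter, Finset.randomSum]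
  refine Finset.sum_bij' (fun G _ => G.edgeFinset) (fun S _ => fromEdgeSet (S : Set (Sym2 W)))
    ?_ ?_ ?_ ?_ ?_
  · intro G _
    refine Finset.mem_powerset.2 fun z hz => ?_
    simpa using G.not_isDiag_of_mem_edgeFinset hz
  · simp
  · simp
  · intro S hS
    rw [← Finset.coe_inj, coe_edgeFinset, edgeSet_fromEdgeSet, sdiff_eq_left, Set.disjoint_left]
    intro z hz hzd
    have := (Finset.mem_filter.1 (Finset.mem_powerset.1 hS hz)).2
    exact this (by simpa using hzd)
  · intro G _
    rw [hsing, coe_edgeFinset, fromEdgeSet_edgeSet]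
    split_ifs <;> simp

variable {V W : Type*} [Fintype V]

/-- A disjoint family of edge sets of copies of `H` yields a family of edge-disjoint copies. -/
lemma hasEdgeDisjointCopies_of_pairwiseDisjoint {H : SimpleGraph V}
    {G : SimpleGraph W} {t : ℝ} {𝓓 : Finset (Finset (Sym2 W))} (ht : t ≤ #𝓓)
    (hdis : (𝓓 : Set (Finset (Sym2 W))).PairwiseDisjoint id)
    (h𝓓 : ∀ A ∈ 𝓓, ∃ f : V → W, Function.Injective f ∧ H.imageEdges f = A ∧
      (A : Set (Sym2 W)) ⊆ G.edgeSet) :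
    H.HasEdgeDisjointCopies G t := by
  classical
  have hK : ∀ A ∈ 𝓓, ∃ K : G.Subgraph, Nonempty (H ≃g K.coe) ∧ K.edgeSet = A := by
    intro A hA
    obtain ⟨f, hf, rfl, hfG⟩ := h𝓓 A hA
    let φ : H →g G := ⟨f, fun {x y} h => hfG (by
      rw [coe_imageEdges]
      exact ⟨s(x, y), h, rfl⟩)⟩
    let c : Copy H G := ⟨φ, hf⟩
    refine ⟨c.toSubgraph, ⟨c.isoToSubgraph⟩, ?_⟩
    rw [coe_imageEdges, Subgraph.edgeSet_map, Subgraph.edgeSet_top]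
    rfl
  choose! K hK hKe using hK
  have hinj : Set.InjOn K 𝓓 := fun A hA B hB h => by
    rw [← Finset.coe_inj, ← hKe A hA, ← hKe B hB, h]
  refine ⟨𝓓.image K, ?_, ?_, ?_⟩
  · rwa [Finset.card_image_of_injOn hinj]
  · intro L hL
    obtain ⟨A, hA, rfl⟩ := Finset.mem_image.1 hL
    exact hK A hA
  · intro L hL L' hL' hne
    obtain ⟨A, hA, rfl⟩ := Finset.mem_image.1 (Finset.mem_coe.1 hL)
    obtain ⟨B, hB, rfl⟩ := Finset.mem_image.1 (Finset.mem_coe.1 hL')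
    rw [hKe A hA, hKe B hB, Finset.disjoint_coe]
    exact hdis hA hB fun h => hne (by rw [h])

end SimpleGraph

/-! ### Assembly of the theorem. -/

theorem lemma2p11 {V : Type*} [Fintype V] (H : SimpleGraph V)
    (hH : H.edgeSet.Nonempty) (hV : 3 ≤ Fintype.card V)
    (d : ℝ) (hd0 : 0 < d) (hd1 : d ≤ 1) :
    ∃ (ρ : ℝ) (n₀ : ℕ) (b : ℝ), 0 < ρ ∧ 0 < n₀ ∧ 0 < b ∧
      ∀ (n : ℕ), n₀ ≤ n → ∀ (p : unitInterval), (p : ℝ) ≤ H.edgeProbBound n →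
        ∀ F : SimpleGraph (Fin n), F.IsRhoDense ρ d →
          1 - (2 : ℝ) ^ (1 - b * (n : ℝ) ^ Fintype.card V * (p : ℝ) ^ H.edgeSet.ncard) ≤
            (SimpleGraph.binomialRandom (Fin n) p).real
              {G : SimpleGraph (Fin n) | H.HasEdgeDisjointCopies (F ⊓ G)
                (b * (n : ℝ) ^ Fintype.card V * (p : ℝ) ^ H.edgeSet.ncard)} := by
  classical
  set v := Fintype.card V with hv
  set e := H.edgeSet.ncard with he
  have he₀ : e ≠ 0 := (Set.ncard_pos (Set.toFinite _)).2 hH |>.ne'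
  set C : ℝ := (v + 1 : ℝ) ^ v with hC
  have hC₀ : 0 < C := by positivity
  obtain ⟨ρ, c, m, hρ, hc, hcl⟩ := SimpleGraph.exists_card_orderedCliques_ge hd0 v
  set β : ℝ := Real.exp (-2 * C) / (16 * (1 + C)) with hβ
  have hβ₀ : 0 < β := by positivity
  -- The threshold ensures `m ≤ n` for the clique count and `2 ^ m* ≤ n`, which forces `p ≤ 1 / 2`.
  -- In `b`, `c / C` is the density of distinct edge sets and `β` the fraction allowed by the lower
  -- tail bound.
  refine ⟨ρ, ⌈max m ((2 : ℝ) ^ H.mStar)⌉₊ + 1, β * (c / C), hρ, Nat.succ_pos _, by positivity, ?_⟩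
  intro n hn p hp F hF
  have hn0 : n ≠ 0 := by omega
  have hmax : max m ((2 : ℝ) ^ H.mStar) ≤ n :=
    (Nat.le_ceil _).trans (by exact_mod_cast (Nat.le_succ _).trans hn)
  have hp₀' : (0 : ℝ) ≤ p := p.2.1
  have hp₁ : (p : ℝ) ≤ 1 := p.2.2
  -- At `p = 0` the claimed lower bound is `1 - 2 = -1`.
  rcases hp₀'.eq_or_lt with h0 | hp₀
  · rw [← h0, zero_pow he₀, mul_zero, sub_zero, Real.rpow_one]
    linarith [MeasureTheory.measureReal_nonneg (μ := SimpleGraph.binomialRandom (Fin n) p)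
      (s := {G : SimpleGraph (Fin n) | H.HasEdgeDisjointCopies (F ⊓ G) 0})]
  have hm : 0 < H.mStar := by
    refine (H.mStar_nonneg hV).lt_of_ne' fun h => ?_
    rw [SimpleGraph.edgeProbBound, if_pos h] at hp
    linarith
  have hp2 : (p : ℝ) ≤ 1 / 2 :=
    hp.trans (H.edgeProbBound_le_half hm ((le_max_right _ _).trans hmax))
  let σ : V ≃ Fin v := Fintype.equivFin V
  let I : Finset (V → Fin n) :=
    (F.orderedCliques Finset.univ v).map (Equiv.arrowCongr σ.symm (Equiv.refl _)).toEmbedding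
  have hIadj : ∀ f ∈ I, ∀ x y, x ≠ y → F.Adj (f x) (f y) := by
    intro f hf x y hxy
    obtain ⟨g, hg, rfl⟩ := Finset.mem_map.1 hf
    exact (SimpleGraph.mem_orderedCliques.1 hg).2 _ _ fun h => hxy (σ.injective h)
  have hIinj : ∀ f ∈ I, Function.Injective f := by
    intro f hf x y h
    by_contra hxy
    exact (hIadj f hf x y hxy).ne h
  have hIcard : c * (n : ℝ) ^ v ≤ #I := by
    have := hcl F Finset.univ (fun S _ hS => hF S (by simpa using hS))
      (by simpa using (le_max_left _ _).trans hmax)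
    simpa [I] using this
  let 𝓗 : Finset (Finset (Sym2 (Fin n))) := I.image H.imageEdges
  have hover : ∀ g ∈ I, ∑ f ∈ I with ¬ Disjoint (H.imageEdges f) (H.imageEdges g),
      (p : ℝ) ^ #(H.imageEdges f \ H.imageEdges g) ≤ C := fun g _ =>
    H.sum_pow_card_imageEdges_sdiff_le hp₀' hp₁ (fun J h2 hJ => by
      simpa using H.pow_mul_pow_le_one_of_le_edgeProbBound hV hn0 hm hp₀ hp₁ hp J h2 hJ)
      g I hIinj
  have hcard𝓗 : ∀ A ∈ 𝓗, #A = e := by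
    intro A hA
    obtain ⟨f, hf, rfl⟩ := Finset.mem_image.1 hA
    exact H.card_imageEdges (hIinj f hf)
  have hdeg : ∀ A ∈ 𝓗, ∑ B ∈ 𝓗 with ¬ Disjoint B A, (p : ℝ) ^ #(B \ A) ≤ C := by
    intro A hA
    obtain ⟨g, hg, rfl⟩ := Finset.mem_image.1 hA
    refine le_trans ?_ (hover g hg)
    rw [Finset.filter_image]
    exact Finset.sum_image_le_of_nonneg fun _ _ => by positivity
  -- Maps with the same edge set as `g` each contribute `p ^ 0 = 1` to the overlap sum, so at most
  -- `C` of them exist.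
  have hmult : (#I : ℝ) ≤ C * #𝓗 := by
    have h1 := Finset.card_le_mul_card_image (f := H.imageEdges) I ((v + 1) ^ v) fun A hA => by
      obtain ⟨g, hg, rfl⟩ := Finset.mem_image.1 hA
      have h2 : (#(I.filter fun f => H.imageEdges f = H.imageEdges g) : ℝ) ≤ C := by
        refine le_trans ?_ (hover g hg)
        rw [Finset.card_eq_sum_ones, Nat.cast_sum]
        calc _ ≤ ∑ f ∈ I with H.imageEdges f = H.imageEdges g,
              (p : ℝ) ^ #(H.imageEdges f \ H.imageEdges g) := by
              refine Finset.sum_le_sum fun f hf => ?_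
              rw [(Finset.mem_filter.1 hf).2]
              simp
          _ ≤ _ := by
              refine Finset.sum_le_sum_of_subset_of_nonneg (fun f hf => ?_)
                fun _ _ _ => by positivity
              obtain ⟨hfI, hfg⟩ := Finset.mem_filter.1 hf
              refine Finset.mem_filter.2 ⟨hfI, fun hd => he₀ ?_⟩
              rw [hfg, disjoint_self] at hd
              rw [← hcard𝓗 _ hA, hd]
              rfl
      rw [hC] at h2
      exact_mod_cast h2
    have h3 : (#I : ℝ) ≤ (((v + 1) ^ v * #𝓗 : ℕ) : ℝ) := by exact_mod_cast h1
    simpa [hC] using h3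
  have h𝓗 : c / C * (n : ℝ) ^ v ≤ #𝓗 := by
    rw [div_mul_eq_mul_div, div_le_iff₀ hC₀]
    linarith
  have hN : c / C * (n : ℝ) ^ v * (p : ℝ) ^ e ≤ #𝓗 * (p : ℝ) ^ e := by gcongr
  set t := β * (c / C) * (n : ℝ) ^ v * (p : ℝ) ^ e with ht
  have htN : t = β * (c / C * (n : ℝ) ^ v * (p : ℝ) ^ e) := by rw [ht]; ring
  set Φ := {G : SimpleGraph (Fin n) | H.HasEdgeDisjointCopies (F ⊓ G) t}
  have hbad : (SimpleGraph.binomialRandom (Fin n) p).real Φᶜ ≤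
      Real.exp (-(Real.exp (-2 * C) / 8) * (#𝓗 * (p : ℝ) ^ e)) := by
    rw [SimpleGraph.binomialRandom_real_eq_randomSum]
    refine Finset.randomSum_no_disjoint_subfamily_le (t := t) hp₀ hp2 hC₀.le he₀ 𝓗 ?_ hcard𝓗 hdeg
      ?_ _ ?_
    · intro A hA z hz
      obtain ⟨f, hf, rfl⟩ := Finset.mem_image.1 hA
      obtain ⟨w, hw, rfl⟩ := SimpleGraph.mem_imageEdges.1 hz
      induction w with | _ x y
      simpa using fun h => H.ne_of_adj hw (hIinj f hf h)
    · rw [htN]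
      gcongr
    · intro S hS 𝓓 h𝓓 hdis hsub
      by_contra hlt
      refine hS (SimpleGraph.hasEdgeDisjointCopies_of_pairwiseDisjoint (not_lt.1 hlt) hdis
        fun A hA => ?_)
      obtain ⟨f, hf, rfl⟩ := Finset.mem_image.1 (h𝓓 hA)
      refine ⟨f, hIinj f hf, rfl, fun z hz => ?_⟩
      have hzS := hsub _ hA hz
      obtain ⟨w, hw, rfl⟩ := SimpleGraph.mem_imageEdges.1 hz
      induction w with | _ x y
      have hadj := hIadj f hf x y (H.ne_of_adj hw)
      exact ⟨hadj, by
        rw [SimpleGraph.fromEdgeSet_adj]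
        exact ⟨hzS, hadj.ne⟩⟩
  have hgood : (SimpleGraph.binomialRandom (Fin n) p).real Φ =
      1 - (SimpleGraph.binomialRandom (Fin n) p).real Φᶜ := by
    rw [MeasureTheory.probReal_compl_eq_one_sub (Set.toFinite Φ).measurableSet]
    ring
  have ht₀ : 0 ≤ t := by positivity
  have hexp : Real.exp (-(Real.exp (-2 * C) / 8) * (#𝓗 * (p : ℝ) ^ e)) ≤ (2 : ℝ) ^ (1 - t) := by
    calc _ ≤ Real.exp (-t) := by
          rw [Real.exp_le_exp, neg_mul, neg_le_neg_iff, htN]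
          have : β ≤ Real.exp (-2 * C) / 8 := by
            rw [hβ]
            gcongr
            linarith
          gcongr
      _ ≤ Real.exp (Real.log 2 * (1 - t)) := by
          rw [Real.exp_le_exp]
          have h1 : Real.log 2 ≤ 1 := by linarith [Real.log_two_lt_d9]
          have h2 : 0 ≤ Real.log 2 := Real.log_nonneg (by norm_num)
          nlinarith
      _ = _ := by rw [Real.rpow_def_of_pos (by norm_num)]
  rw [hgood]
  linarith
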